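/- Corollary. There exists a universal constant $c>0$ such that the following holds. Let $n$ be a positive integer, let $g\in\mathbb{R}^n$ be a standard gaussian vector (i.e. its entries are independent gaussians with mean $0$ and variance $1$), and let $A=(a_{i,j})$ be a nonzero real symmetric $n\times n$ matrix (its diagonal is allowed to be nonzero). Then for all real $t\ge 1$, $$\Pr_g\left(|g^TAg-\mathrm{tr}(A)|>c\left(\sqrt t\,\|A\|_F+t\,\|A\|\right)\right)\ \ge\ \min\{c,e^{-t}\},$$ where $\|A\|_F=(\sum_{i,j}a_{i,j}^2)^{1/2}$ is the Frobenius norm and $\|A\|$ is the $\ell_2\to\ell_2$ operator norm. -/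

import Mathlib

open MeasureTheory ProbabilityTheory

noncomputable section

/-- The Frobenius norm of a real square matrix: the square root of the sum of squared entries. -/
def frobeniusNorm {n : ℕ} (A : Matrix (Fin n) (Fin n) ℝ) : ℝ :=
  Real.sqrt (∑ i, ∑ j, A i j ^ 2)

/-- The operator norm of a real square matrix acting on Euclidean space. -/
def euclideanOpNorm {n : ℕ} (A : Matrix (Fin n) (Fin n) ℝ) : ℝ :=
  ‖Matrix.toEuclideanCLM (n := Fin n) (𝕜 := ℝ) A‖

/-- The quadratic form `xᵀ A x`. -/
def quadForm {n : ℕ} (A : Matrix (Fin n) (Fin n) ℝ) (x : EuclideanSpace ℝ (Fin n)) : ℝ :=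
  ∑ i, ∑ j, A i j * x i * x j

end

open MeasureTheory ProbabilityTheory

/-! By rotation invariance, expanding `g` in an eigenbasis of `A` turns the centred form into `W = ∑
λ_i (x_i² - 1)` with independent standard gaussians `x_i`. Write `σ = ‖A‖_F` and `L = max |λ_i|`. If
`L` is at most about `σ / √t`, the exponential moments of `W` at `s ~ √t / σ` are `exp(Θ(t))`, and
Paley–Zygmund for `exp (s W)` gives `W ≳ √t σ` with probability `exp(-O(t))`
(`weightedChiSq_tail_of_small_coeff`). Otherwise `t L` dominates, and the top coordinate alone, with
the others frozen, gives `|W| > t L` (`weightedChiSq_tail_of_coeff`). Rescaling `t` turns `exp(-36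
t) / 4` into `min c (exp (-t))`. -/

/-- A form of the Paley–Zygmund inequality in terms of bounds on the first two moments. -/
theorem paley_zygmund {Ω : Type*} [MeasurableSpace Ω] {μ : Measure Ω} [IsProbabilityMeasure μ]
    {Z : Ω → ℝ} (hZm : Measurable Z) (hZ : Integrable Z μ) (hZ2 : Integrable (fun ω => Z ω ^ 2) μ)
    {m V : ℝ} (hm : 0 < m) (hV : 0 < V) (hmZ : m ≤ ∫ ω, Z ω ∂μ) (hVZ : ∫ ω, Z ω ^ 2 ∂μ ≤ V) :
    m ^ 2 / (4 * V) ≤ μ.real {ω | m / 2 < Z ω} := by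
  set S := {ω | m / 2 < Z ω} with hS
  have hSm : MeasurableSet S := measurableSet_lt measurable_const hZm
  -- AM-GM on `S` bounds `Z` by `a/2 * Z² + 1/(2a)`; this `a` makes the second-moment term at most
  -- `m/4`.
  set a := m / (2 * V) with ha
  have ha0 : 0 < a := by positivity
  have hind : Integrable (S.indicator (fun _ => 1 / (2 * a))) μ :=
    (integrable_const _).indicator hSm
  have key : ∫ ω, Z ω ∂μ ≤
      ∫ ω, (m / 2 + a / 2 * Z ω ^ 2 + S.indicator (fun _ => 1 / (2 * a)) ω) ∂μ := by
    refine integral_mono hZ (((integrable_const _).add (hZ2.const_mul _)).add hind) fun ω => ?_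
    by_cases h : ω ∈ S
    · simp only [Set.indicator_of_mem h]
      have : Z ω ≤ a / 2 * Z ω ^ 2 + 1 / (2 * a) := by
        have : a / 2 * Z ω ^ 2 + 1 / (2 * a) - Z ω = (a * Z ω - 1) ^ 2 / (2 * a) := by
          field_simp; ring
        have h2 : 0 ≤ (a * Z ω - 1) ^ 2 / (2 * a) := by positivity
        linarith
      linarith
    · simp only [Set.indicator_of_notMem h]
      have h1 : Z ω ≤ m / 2 := not_lt.1 h
      have h2 : 0 ≤ a / 2 * Z ω ^ 2 := by positivity
      linarith
  rw [integral_add (f := fun ω => m / 2 + a / 2 * Z ω ^ 2)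
      ((integrable_const _).add (hZ2.const_mul _)) hind,
    integral_add (integrable_const _) (hZ2.const_mul _), integral_const_mul,
    integral_indicator_const _ hSm] at key
  simp only [integral_const, probReal_univ, smul_eq_mul, one_mul] at key
  have h3 : a / 2 * ∫ ω, Z ω ^ 2 ∂μ ≤ m / 4 := by
    calc a / 2 * ∫ ω, Z ω ^ 2 ∂μ ≤ a / 2 * V := by gcongr
      _ = m / 4 := by rw [ha]; field_simp; norm_num
  have h4 : m / 4 ≤ μ.real S * (1 / (2 * a)) := by linarith
  have h5 : μ.real S * (1 / (2 * a)) = μ.real S * V / m := by rw [ha]; field_simp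
  rw [h5, le_div_iff₀ hm] at h4
  rw [div_le_iff₀ (by positivity)]
  nlinarith

/-! ### Exponential moments of weighted chi-square sums -/

theorem integrable_exp_mul_sq_sub_one_gaussianReal {u : ℝ} (hu : 2 * u < 1) :
    Integrable (fun x => Real.exp (u * (x ^ 2 - 1))) (gaussianReal 0 1) := by
  rw [gaussianReal_of_var_ne_zero _ one_ne_zero,
    integrable_withDensity_iff_integrable_smul₀' (by fun_prop) (by simp [gaussianPDF])]
  have h := ((integrable_exp_neg_mul_sq (b := 1 / 2 - u) (by linarith)).const_mul
    ((√(2 * Real.pi))⁻¹ * Real.exp (-u)))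
  refine h.congr (Filter.Eventually.of_forall fun x => ?_)
  simp only [toReal_gaussianPDF, gaussianPDFReal, smul_eq_mul, NNReal.coe_one, mul_one, sub_zero,
    mul_assoc, ← Real.exp_add]
  ring_nf

theorem integral_exp_mul_sq_sub_one_gaussianReal {u : ℝ} (hu : 2 * u < 1) :
    ∫ x, Real.exp (u * (x ^ 2 - 1)) ∂(gaussianReal 0 1) =
      Real.exp (-(2 * u + Real.log (1 - 2 * u)) / 2) := by
  have h0 : 0 < 1 - 2 * u := by linarith
  rw [integral_gaussianReal_eq_integral_smul one_ne_zero]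
  have : ∀ x : ℝ, gaussianPDFReal 0 1 x • Real.exp (u * (x ^ 2 - 1)) =
      ((√(2 * Real.pi))⁻¹ * Real.exp (-u)) * Real.exp (-(1 / 2 - u) * x ^ 2) := by
    intro x
    simp only [gaussianPDFReal, smul_eq_mul, NNReal.coe_one, mul_one, sub_zero,
      mul_assoc, ← Real.exp_add]
    ring_nf
  simp_rw [this]
  rw [integral_const_mul, integral_gaussian]
  have h1 : Real.exp (-(2 * u + Real.log (1 - 2 * u)) / 2) =
      Real.exp (-u) * (√(1 - 2 * u))⁻¹ := by
    rw [show -(2 * u + Real.log (1 - 2 * u)) / 2 = -u + -(Real.log (1 - 2 * u) / 2) by ring,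
      Real.exp_add, Real.exp_neg (Real.log _ / 2), ← Real.log_sqrt h0.le,
      Real.exp_log (Real.sqrt_pos.2 h0)]
  rw [h1, show Real.pi / (1 / 2 - u) = 2 * Real.pi / (1 - 2 * u) by field_simp,
    Real.sqrt_div (by positivity)]
  field_simp

/-- The quadratic Taylor term is `x²/2`, and the remainder is at most `x²/3` in this range. -/
theorem neg_add_log_one_sub_bounds {x : ℝ} (hx : |x| ≤ 1 / 4) :
    x ^ 2 / 6 ≤ -(x + Real.log (1 - x)) ∧ -(x + Real.log (1 - x)) ≤ 5 * x ^ 2 / 6 := by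
  have h := Real.abs_log_sub_add_sum_range_le (x := x) (by linarith) 2
  norm_num [Finset.sum_range_succ] at h
  have h2 : |x| ^ 3 / (1 - |x|) ≤ x ^ 2 / 3 := by
    rw [div_le_iff₀ (by linarith), ← sq_abs x]
    nlinarith [sq_nonneg |x|]
  have := abs_le.1 (h.trans h2)
  constructor <;> linarith [this.1, this.2]

/-- The centred weighted chi-square sum `∑ i, l i * (x i ^ 2 - 1)`. -/
def weightedChiSq {n : ℕ} (l x : Fin n → ℝ) : ℝ := ∑ i, l i * (x i ^ 2 - 1)

/-- The standard Gaussian measure on `Fin n → ℝ`. -/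
noncomputable abbrev gaussianPi (n : ℕ) : Measure (Fin n → ℝ) :=
  Measure.pi fun _ => gaussianReal 0 1

theorem measurable_weightedChiSq {n : ℕ} (l : Fin n → ℝ) : Measurable (weightedChiSq l) := by
  unfold weightedChiSq
  fun_prop

theorem exp_mul_weightedChiSq {n : ℕ} (l x : Fin n → ℝ) (s : ℝ) :
    Real.exp (s * weightedChiSq l x) = ∏ i, Real.exp (s * l i * (x i ^ 2 - 1)) := by
  rw [← Real.exp_sum, weightedChiSq, Finset.mul_sum]
  simp_rw [mul_assoc]

theorem integrable_exp_mul_weightedChiSq {n : ℕ} {l : Fin n → ℝ} {s : ℝ}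
    (h : ∀ i, 2 * (s * l i) < 1) :
    Integrable (fun x => Real.exp (s * weightedChiSq l x)) (gaussianPi n) := by
  simp_rw [exp_mul_weightedChiSq]
  exact Integrable.fintype_prod (f := fun i x => Real.exp (s * l i * (x ^ 2 - 1))) fun i =>
    integrable_exp_mul_sq_sub_one_gaussianReal (h i)

theorem integral_exp_mul_weightedChiSq {n : ℕ} {l : Fin n → ℝ} {s : ℝ}
    (h : ∀ i, 2 * (s * l i) < 1) :
    ∫ x, Real.exp (s * weightedChiSq l x) ∂(gaussianPi n) =
      Real.exp (∑ i, -(2 * (s * l i) + Real.log (1 - 2 * (s * l i))) / 2) := by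
  simp_rw [exp_mul_weightedChiSq]
  rw [integral_fintype_prod_eq_prod (f := fun i x => Real.exp (s * l i * (x ^ 2 - 1))),
    Real.exp_sum]
  exact Finset.prod_congr rfl fun i _ => integral_exp_mul_sq_sub_one_gaussianReal (h i)

theorem integral_exp_mul_weightedChiSq_bounds {n : ℕ} {l : Fin n → ℝ} {s : ℝ}
    (h : ∀ i, |2 * (s * l i)| ≤ 1 / 4) :
    Real.exp (s ^ 2 * (∑ i, l i ^ 2) / 3) ≤ ∫ x, Real.exp (s * weightedChiSq l x) ∂(gaussianPi n) ∧
    ∫ x, Real.exp (s * weightedChiSq l x) ∂(gaussianPi n) ≤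
      Real.exp (5 * s ^ 2 * (∑ i, l i ^ 2) / 3) := by
  rw [integral_exp_mul_weightedChiSq fun i => by linarith [le_abs_self (2 * (s * l i)), h i]]
  simp only [Real.exp_le_exp, Finset.mul_sum, Finset.sum_div]
  constructor <;> refine Finset.sum_le_sum fun i _ => ?_
  · linarith [(neg_add_log_one_sub_bounds (h i)).1]
  · linarith [(neg_add_log_one_sub_bounds (h i)).2]

/-! ### Small coefficients: Paley–Zygmund for the exponential -/

theorem weightedChiSq_tail_of_exp {n : ℕ} {l : Fin n → ℝ} {s v : ℝ}
    (h : ∀ i, |4 * (s * l i)| ≤ 1 / 4) (hv : v = s ^ 2 * ∑ i, l i ^ 2) (hv6 : 6 ≤ v) :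
    Real.exp (-6 * v) / 4 ≤ (gaussianPi n).real {x | v / 6 < s * weightedChiSq l x} := by
  have h2 : ∀ i, |2 * (s * l i)| ≤ 1 / 4 := fun i => by
    have := h i
    rw [abs_mul] at this ⊢
    norm_num at this ⊢
    linarith [abs_nonneg (s * l i)]
  have h4 : ∀ i, |2 * ((2 * s) * l i)| ≤ 1 / 4 := fun i => by convert h i using 2; ring
  have hsq : ∀ x, Real.exp (s * weightedChiSq l x) ^ 2 = Real.exp ((2 * s) * weightedChiSq l x) :=
    fun x => by rw [← Real.exp_nat_mul]; push_cast; ring_nf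
  -- The second moment is the exponential moment at `2 * s`, hence the factor 4 in `h`.
  have pz := paley_zygmund (μ := gaussianPi n) (Z := fun x => Real.exp (s * weightedChiSq l x))
    (m := Real.exp (v / 3)) (V := Real.exp (20 * v / 3))
    (((measurable_weightedChiSq l).const_mul s).exp)
    (integrable_exp_mul_weightedChiSq fun i => by linarith [le_abs_self (2 * (s * l i)), h2 i])
    (by
      simp_rw [hsq]
      exact integrable_exp_mul_weightedChiSq fun i => by
        linarith [le_abs_self (2 * (2 * s * l i)), h4 i])
    (Real.exp_pos _) (Real.exp_pos _)
    (by rw [hv]; exact (integral_exp_mul_weightedChiSq_bounds h2).1)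
    (by
      simp_rw [hsq]
      refine (integral_exp_mul_weightedChiSq_bounds h4).2.trans_eq ?_
      rw [hv]; ring_nf)
  have e1 : Real.exp (v / 3) ^ 2 / (4 * Real.exp (20 * v / 3)) = Real.exp (-6 * v) / 4 := by
    rw [← Real.exp_nat_mul, mul_comm 4, ← div_div, ← Real.exp_sub]
    congr 2
    push_cast; ring
  rw [e1] at pz
  refine pz.trans (measureReal_mono fun x hx => ?_)
  have hx' : Real.exp (v / 3) / 2 < Real.exp (s * weightedChiSq l x) := hx
  -- Here `6 ≤ v` enters: it gives `2 ≤ exp (v / 6)`.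
  have h5 : Real.exp (v / 6) ≤ Real.exp (v / 3) / 2 := by
    have : Real.exp (v / 3) = Real.exp (v / 6) * Real.exp (v / 6) := by
      rw [← Real.exp_add]; ring_nf
    have h6 : v / 6 + 1 ≤ Real.exp (v / 6) := Real.add_one_le_exp _
    nlinarith [Real.exp_pos (v / 6)]
  exact Real.exp_lt_exp.1 (h5.trans_lt hx')

theorem weightedChiSq_tail_of_small_coeff {n : ℕ} {l : Fin n → ℝ} {σ L t : ℝ} (hσ : 0 < σ)
    (hσl : σ ^ 2 = ∑ i, l i ^ 2) (hL : ∀ i, |l i| ≤ L) (ht : 1 ≤ t) (hLσ : 40 * √t * L ≤ σ) :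
    Real.exp (-36 * t) / 4 ≤ (gaussianPi n).real {x | √t * σ / 3 < weightedChiSq l x} := by
  have ht0 : 0 < √t := Real.sqrt_pos.2 (by linarith)
  have h6 : √6 ≤ 5 / 2 := Real.sqrt_le_iff.2 (by norm_num)
  have h60 : 0 < √6 := by positivity
  have h66 : √6 ^ 2 = 6 := Real.sq_sqrt (by norm_num)
  have htt : √t ^ 2 = t := Real.sq_sqrt (by linarith)
  have hs0 : 0 < √6 * √t / σ := by positivity
  -- This `s` gives `v = 6 * t`; the condition `s * |l i| ≤ 1/16` with `√6 ≤ 5/2` accounts for the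
  -- 40 in `hLσ`.
  have := weightedChiSq_tail_of_exp (l := l) (s := √6 * √t / σ) (v := 6 * t) (fun i => by
      rw [abs_mul, abs_mul, abs_of_pos hs0, abs_of_pos (by norm_num : (0 : ℝ) < 4)]
      have : √6 * √t / σ * |l i| ≤ 1 / 16 := by
        rw [div_mul_eq_mul_div, div_le_iff₀ hσ]
        have h1 : √t * |l i| ≤ √t * L := by gcongr; exact hL i
        have h2 : √6 * (√t * |l i|) ≤ 5 / 2 * (√t * |l i|) := by gcongr
        nlinarith
      linarith)
    (by rw [← hσl, div_pow, mul_pow, h66, htt]; field_simp) (by linarith)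
  rw [show -6 * (6 * t) = -36 * t by ring] at this
  refine this.trans (measureReal_mono fun x hx => ?_)
  have hx' : 6 * t / 6 < √6 * √t / σ * weightedChiSq l x := hx
  rw [div_mul_eq_mul_div, lt_div_iff₀ hσ] at hx'
  show √t * σ / 3 < weightedChiSq l x
  have h1 : √t * (√t * σ) < √t * (√6 * weightedChiSq l x) := by nlinarith
  have h2 := lt_of_mul_lt_mul_left h1 ht0.le
  have h3 : 0 < weightedChiSq l x := by
    have : 0 < √6 * weightedChiSq l x := lt_trans (by positivity) h2
    exact pos_of_mul_pos_right this h60.le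
  nlinarith

/-! ### One large coefficient: anti-concentration -/

theorem gaussianReal_Ioo_lower_bound {r : ℝ} (hr : 0 ≤ r) :
    Real.exp (-1 - (r + 1) ^ 2 / 2) ≤ (gaussianReal 0 1).real (Set.Ioo r (r + 1)) := by
  rw [measureReal_def, gaussianReal_apply_eq_integral _ one_ne_zero,
    ENNReal.toReal_ofReal (setIntegral_nonneg measurableSet_Ioo fun x _ =>
      gaussianPDFReal_nonneg _ _ _)]
  have h1 : ∫ _ in Set.Ioo r (r + 1), Real.exp (-1 - (r + 1) ^ 2 / 2) ≤
      ∫ x in Set.Ioo r (r + 1), gaussianPDFReal 0 1 x := by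
    refine setIntegral_mono_on (by simp) (integrable_gaussianPDFReal _ _).integrableOn
      measurableSet_Ioo fun x hx => ?_
    simp only [gaussianPDFReal, NNReal.coe_one, mul_one, sub_zero]
    rw [sub_eq_add_neg, Real.exp_add]
    gcongr
    · rw [Real.exp_neg]
      gcongr
      refine Real.sqrt_le_iff.2 ⟨(Real.exp_pos _).le, ?_⟩
      nlinarith [Real.exp_one_gt_d9, Real.pi_lt_d2]
    · have : x ^ 2 ≤ (r + 1) ^ 2 := by
        have := hx.1; have := hx.2
        gcongr
        linarith
      linarith
  simpa using h1

/-- A one-dimensional anti-concentration bound, uniform in the shift `y`. -/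
theorem gaussianReal_shifted_sq_tail {k a : ℝ} (hk : k ≠ 0) (ha : 0 ≤ a) (y : ℝ) :
    Real.exp (-3 - 2 * a) ≤
      (gaussianReal 0 1).real {x | a * |k| < |k * (x ^ 2 - 1) + y|} := by
  have hk0 : 0 < |k| := abs_pos.2 hk
  have hset : {x : ℝ | a * |k| < |k * (x ^ 2 - 1) + y|} = {x | a < |(x ^ 2 - 1) + y / k|} := by
    ext x
    have : k * (x ^ 2 - 1) + y = k * ((x ^ 2 - 1) + y / k) := by field_simp
    simp only [Set.mem_ofPred_eq]
    rw [this, abs_mul, mul_comm a, mul_lt_mul_iff_right₀ hk0]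
  rw [hset]
  -- A very negative shift is kept below `-a` by `x² < 1`; any other is beaten by `x² - 1 > 2 * a`.
  by_cases hy : a < -(y / k)
  · refine le_trans ?_ ((gaussianReal_Ioo_lower_bound le_rfl).trans
      (measureReal_mono (μ := gaussianReal 0 1) fun x hx => ?_))
    · rw [Real.exp_le_exp]; linarith
    · have h1 : x ^ 2 < 1 := by have := hx.1; have := hx.2; nlinarith
      show a < |x ^ 2 - 1 + y / k|
      exact lt_abs.2 (Or.inr (by linarith))
  · set r := √(1 + 2 * a)
    have hr : r ^ 2 = 1 + 2 * a := Real.sq_sqrt (by linarith)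
    have hr0 : 0 ≤ r := Real.sqrt_nonneg _
    refine le_trans ?_ ((gaussianReal_Ioo_lower_bound hr0).trans
      (measureReal_mono (μ := gaussianReal 0 1) fun x hx => ?_))
    · rw [Real.exp_le_exp]; nlinarith [sq_nonneg (r - 1)]
    · have h1 : r ^ 2 < x ^ 2 := by have := hx.1; gcongr
      show a < |x ^ 2 - 1 + y / k|
      exact lt_abs.2 (Or.inl (by linarith))

/-- By Fubini, the other coordinates only contribute a shift, to which the one-dimensional bound is
insensitive. -/
theorem weightedChiSq_tail_of_coeff {n : ℕ} {l : Fin n → ℝ} {i : Fin n} (hi : l i ≠ 0) {a : ℝ}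
    (ha : 0 ≤ a) :
    Real.exp (-3 - 2 * a) ≤ (gaussianPi n).real {x | a * |l i| < |weightedChiSq l x|} := by
  obtain _ | n := n
  · exact i.elim0
  have hmeas : MeasurableSet {x | a * |l i| < |weightedChiSq l x|} :=
    measurableSet_lt measurable_const (measurable_weightedChiSq l).abs
  have hmp := (measurePreserving_piFinSuccAbove
    (fun _ : Fin (n + 1) => gaussianReal 0 1) i).symm
  rw [measureReal_def, ← hmp.measure_preimage hmeas.nullMeasurableSet, Measure.prod_apply_symm
    (hmp.measurable hmeas)]
  refine (ENNReal.ofReal_le_iff_le_toReal ?_).1 ?_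
  · refine ne_of_lt (lt_of_le_of_lt (lintegral_mono fun _ => prob_le_one) ?_)
    simp
  · calc ENNReal.ofReal (Real.exp (-3 - 2 * a))
        = ∫⁻ _, ENNReal.ofReal (Real.exp (-3 - 2 * a)) ∂(gaussianPi n) := by simp
      _ ≤ _ := by
        refine lintegral_mono fun y => ?_
        refine (ENNReal.ofReal_le_iff_le_toReal (measure_ne_top _ _)).2 ?_
        refine (gaussianReal_shifted_sq_tail hi ha
          (weightedChiSq (fun j => l (i.succAbove j)) y)).trans_eq ?_
        rw [measureReal_def]
        congr 2
        ext x
        simp [weightedChiSq, Fin.sum_univ_succAbove _ i]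

/-! ### Combining the two regimes -/

theorem weightedChiSq_tail {n : ℕ} {l : Fin n → ℝ} {σ t : ℝ} {i : Fin n} (hi : l i ≠ 0)
    (hmax : ∀ j, |l j| ≤ |l i|) (hσ : 0 ≤ σ) (hσl : σ ^ 2 = ∑ i, l i ^ 2) (ht : 1 ≤ t) :
    Real.exp (-36 * t) / 4 ≤
      (gaussianPi n).real {x | (√t * σ + t * |l i|) / 41 < |weightedChiSq l x|} := by
  have hL : 0 < |l i| := abs_pos.2 hi
  have htt : √t * √t = t := Real.mul_self_sqrt (by linarith)
  have ht0 : 0 < √t := Real.sqrt_pos.2 (by linarith)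
  have hσ0 : 0 < σ := by
    refine hσ.lt_of_ne fun h => hi ?_
    have : l i ^ 2 ≤ ∑ i, l i ^ 2 :=
      Finset.single_le_sum (f := fun i => l i ^ 2) (fun j _ => sq_nonneg _) (Finset.mem_univ i)
    rw [← hσl, ← h] at this
    exact pow_eq_zero_iff two_ne_zero |>.1 (le_antisymm (by simpa using this) (sq_nonneg _))
  by_cases hc : 40 * √t * |l i| ≤ σ
  · refine (weightedChiSq_tail_of_small_coeff hσ0 hσl hmax ht hc).trans
      (measureReal_mono fun x hx => ?_)
    have hx' : √t * σ / 3 < weightedChiSq l x := hx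
    show (√t * σ + t * |l i|) / 41 < |weightedChiSq l x|
    have : √t * (40 * √t * |l i|) ≤ √t * σ := by gcongr
    have h2 : 0 < √t * σ := by positivity
    have h3 := le_abs_self (weightedChiSq l x)
    nlinarith
  · have h1 := weightedChiSq_tail_of_coeff (n := n) hi (a := t) (by linarith)
    refine le_trans ?_ (h1.trans (measureReal_mono fun x hx => ?_))
    · have : Real.exp (-36 * t) ≤ Real.exp (-3 - 2 * t) := by
        rw [Real.exp_le_exp]; linarith
      linarith [Real.exp_pos (-36 * t)]
    · have hx' : t * |l i| < |weightedChiSq l x| := hx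
      show (√t * σ + t * |l i|) / 41 < |weightedChiSq l x|
      have : √t * σ ≤ √t * (40 * √t * |l i|) := by gcongr; exact (not_le.1 hc).le
      nlinarith

theorem weightedChiSq_tail_exp_neg {n : ℕ} {l : Fin n → ℝ} {σ t : ℝ} {i : Fin n} (hi : l i ≠ 0)
    (hmax : ∀ j, |l j| ≤ |l i|) (hσ : 0 ≤ σ) (hσl : σ ^ 2 = ∑ i, l i ^ 2) :
    min (Real.exp (-36) / 4) (Real.exp (-t)) ≤
      (gaussianPi n).real {x | (√t * σ + t * |l i|) / 2952 < |weightedChiSq l x|} := by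
  have hL : 0 < |l i| := abs_pos.2 hi
  have aux : ∀ s : ℝ, 1 ≤ s → t ≤ 72 * s → Real.exp (-36 * s) / 4 ≤
      (gaussianPi n).real {x | (√t * σ + t * |l i|) / 2952 < |weightedChiSq l x|} := by
    intro s hs hts
    refine (weightedChiSq_tail hi hmax hσ hσl hs).trans (measureReal_mono fun x hx => ?_)
    have hx' : (√s * σ + s * |l i|) / 41 < |weightedChiSq l x| := hx
    refine lt_of_le_of_lt (b := (√s * σ + s * |l i|) / 41) ?_ hx'
    have h1 : √t ≤ 72 * √s := by
      rw [Real.sqrt_le_iff]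
      refine ⟨by positivity, ?_⟩
      rw [mul_pow, Real.sq_sqrt (by linarith)]
      linarith
    have h2 : √t * σ ≤ 72 * √s * σ := by gcongr
    have h3 : t * |l i| ≤ 72 * s * |l i| := by gcongr
    linarith
  -- Use `s = max 1 (t / 72)`: for large `t` the exponent is only `-t/2`, and the spare `exp (t /
  -- 2)` absorbs the `1/4`. Here `2952 = 41 * 72`.
  by_cases h : t ≤ 72
  · exact (min_le_left _ _).trans (by simpa using aux 1 le_rfl (by linarith))
  · refine (min_le_right _ _).trans (le_trans ?_ (aux (t / 72) (by linarith) (by linarith)))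
    have h1 : Real.exp (-36 * (t / 72)) = Real.exp (-t) * Real.exp (t / 2) := by
      rw [← Real.exp_add]; ring_nf
    have h2 := Real.add_one_le_exp (t / 2)
    rw [h1]
    nlinarith [Real.exp_pos (-t)]

section Diagonalization

variable {n : ℕ} {A : Matrix (Fin n) (Fin n) ℝ}

theorem quadForm_eq_inner (A : Matrix (Fin n) (Fin n) ℝ) (x : EuclideanSpace ℝ (Fin n)) :
    quadForm A x = inner ℝ x (Matrix.toEuclideanCLM (n := Fin n) (𝕜 := ℝ) A x) := by
  simp only [quadForm, PiLp.inner_apply, Matrix.ofLp_toEuclideanCLM, Matrix.mulVec, dotProduct,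
    RCLike.inner_apply, conj_trivial, Finset.sum_mul]
  exact Finset.sum_congr rfl fun i _ => Finset.sum_congr rfl fun j _ => by ring

theorem toEuclideanCLM_eigenvectorBasis (hA : A.IsHermitian) (i : Fin n) :
    Matrix.toEuclideanCLM (n := Fin n) (𝕜 := ℝ) A (hA.eigenvectorBasis i) =
      hA.eigenvalues i • hA.eigenvectorBasis i := by
  ext j
  have := congrFun (hA.mulVec_eigenvectorBasis i) j
  simpa [Matrix.ofLp_toEuclideanCLM] using this

theorem toEuclideanCLM_sum_eigenvectorBasis (hA : A.IsHermitian) (x : Fin n → ℝ) :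
    Matrix.toEuclideanCLM (n := Fin n) (𝕜 := ℝ) A (∑ i, x i • hA.eigenvectorBasis i) =
      ∑ i, (hA.eigenvalues i * x i) • hA.eigenvectorBasis i := by
  simp [map_sum, toEuclideanCLM_eigenvectorBasis, smul_smul, mul_comm]

theorem inner_sum_orthonormalBasis (b : OrthonormalBasis (Fin n) ℝ (EuclideanSpace ℝ (Fin n)))
    (x y : Fin n → ℝ) : inner ℝ (∑ i, x i • b i) (∑ i, y i • b i) = ∑ i, x i * y i := by
  simpa using b.orthonormal.inner_sum x y Finset.univ

theorem quadForm_sum_eigenvectorBasis (hA : A.IsHermitian) (x : Fin n → ℝ) :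
    quadForm A (∑ i, x i • hA.eigenvectorBasis i) - A.trace =
      weightedChiSq hA.eigenvalues x := by
  rw [quadForm_eq_inner, toEuclideanCLM_sum_eigenvectorBasis, inner_sum_orthonormalBasis,
    hA.trace_eq_sum_eigenvalues, weightedChiSq, ← Finset.sum_sub_distrib]
  exact Finset.sum_congr rfl fun i _ => by simp; ring

/-- Only this direction is needed, since the operator norm enters only through the threshold. -/
theorem euclideanOpNorm_le (hA : A.IsHermitian) {L : ℝ} (hL0 : 0 ≤ L)
    (hL : ∀ i, |hA.eigenvalues i| ≤ L) : euclideanOpNorm A ≤ L := by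
  refine ContinuousLinearMap.opNorm_le_bound _ hL0 fun v => ?_
  set x : Fin n → ℝ := fun i => hA.eigenvectorBasis.repr v i
  have hv : v = ∑ i, x i • hA.eigenvectorBasis i := (hA.eigenvectorBasis.sum_repr v).symm
  refine abs_le_of_sq_le_sq' ?_ (by positivity) |>.2
  rw [mul_pow, hv, toEuclideanCLM_sum_eigenvectorBasis, ← real_inner_self_eq_norm_sq,
    ← real_inner_self_eq_norm_sq, inner_sum_orthonormalBasis, inner_sum_orthonormalBasis,
    Finset.mul_sum]
  refine Finset.sum_le_sum fun i _ => ?_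
  have : hA.eigenvalues i ^ 2 ≤ L ^ 2 := sq_le_sq' (abs_le.1 (hL i)).1 (abs_le.1 (hL i)).2
  nlinarith [mul_le_mul_of_nonneg_right this (sq_nonneg (x i))]

theorem frobeniusNorm_sq (hA : A.IsHermitian) :
    frobeniusNorm A ^ 2 = ∑ i, hA.eigenvalues i ^ 2 := by
  have h1 : ∑ i, ∑ j, A i j ^ 2 = (A * A).trace := by
    simp only [Matrix.trace, Matrix.diag, Matrix.mul_apply]
    refine Finset.sum_congr rfl fun i _ => Finset.sum_congr rfl fun j _ => ?_
    have := hA.apply i j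
    simp only [star_trivial] at this
    rw [this, sq]
  rw [frobeniusNorm, Real.sq_sqrt (by positivity), h1]
  conv_lhs => rw [hA.spectral_theorem, ← map_mul, Unitary.conjStarAlgAut_apply,
    Matrix.trace_mul_cycle, Unitary.coe_star_mul_self, one_mul, Matrix.diagonal_mul_diagonal,
    Matrix.trace_diagonal]
  exact Finset.sum_congr rfl fun i _ => by simp [sq]

end Diagonalization

theorem mainTheorem2 :
    ∃ c : ℝ, 0 < c ∧
      ∀ (n : ℕ) (A : Matrix (Fin n) (Fin n) ℝ), A.IsSymm → A ≠ 0 →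
      ∀ (Ω : Type*) [MeasurableSpace Ω] (P : Measure Ω) [IsProbabilityMeasure P]
        (g : Ω → EuclideanSpace ℝ (Fin n)),
        HasLaw g (stdGaussian (EuclideanSpace ℝ (Fin n))) P →
      ∀ t : ℝ, 1 ≤ t →
        min c (Real.exp (-t)) ≤
          P.real {ω | c * (Real.sqrt t * frobeniusNorm A + t * euclideanOpNorm A)
            < |quadForm A (g ω) - A.trace|} := by
  have hc0 : 0 < Real.exp (-36) / 2952 := by positivity
  have hc1 : Real.exp (-36) / 2952 ≤ 1 / 2952 := by
    gcongr
    exact Real.exp_le_one_iff.2 (by norm_num)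
  -- One constant lying below both the probability floor `exp (-36) / 4` and the threshold factor `1
  -- / 2952`.
  refine ⟨Real.exp (-36) / 2952, hc0, fun n A hsymm hA0 Ω _ P _ g hg t ht => ?_⟩
  set c := Real.exp (-36) / 2952 with hc
  have hA : A.IsHermitian := by
    rw [Matrix.IsHermitian, Matrix.conjTranspose_eq_transpose_of_trivial]; exact hsymm
  obtain ⟨i₀, hi₀⟩ : ∃ i, hA.eigenvalues i ≠ 0 := by
    by_contra! h
    exact hA0 (hA.eigenvalues_eq_zero_iff.1 (funext h))
  have : Nonempty (Fin n) := ⟨i₀⟩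
  obtain ⟨i, hi⟩ := Finite.exists_max fun i => |hA.eigenvalues i|
  have hi0 : hA.eigenvalues i ≠ 0 := abs_pos.1 ((abs_pos.2 hi₀).trans_le (hi i₀))
  have hq : Measurable (quadForm A) := by unfold quadForm; fun_prop
  set K := c * (√t * frobeniusNorm A + t * euclideanOpNorm A) with hK
  have hS : MeasurableSet {x | K < |quadForm A x - A.trace|} :=
    measurableSet_lt measurable_const (hq.sub_const _).abs
  have hP : P.real {ω | K < |quadForm A (g ω) - A.trace|} =
      (gaussianPi n).real {x | K < |weightedChiSq hA.eigenvalues x|} := by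
    have h1 : P.real {ω | K < |quadForm A (g ω) - A.trace|} =
        (P.map g).real {x | K < |quadForm A x - A.trace|} := by
      rw [map_measureReal_apply_of_aemeasurable hg.aemeasurable hS]
      rfl
    rw [h1, hg.map_eq, stdGaussian_eq_map_pi_orthonormalBasis hA.eigenvectorBasis,
      map_measureReal_apply (by fun_prop) hS]
    congr 1
    ext x
    simp only [Set.mem_preimage, Set.mem_ofPred_eq, quadForm_sum_eigenvectorBasis hA]
  rw [hP]
  have hF : 0 ≤ frobeniusNorm A := Real.sqrt_nonneg _
  have hO := euclideanOpNorm_le hA (abs_nonneg _) hi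
  have hO0 : 0 ≤ euclideanOpNorm A := norm_nonneg _
  refine le_trans (min_le_min_right _ ?_) ((weightedChiSq_tail_exp_neg hi0 hi hF
    (frobeniusNorm_sq hA)).trans (measureReal_mono fun x hx => ?_))
  · rw [hc]
    linarith [Real.exp_pos (-36)]
  · show K < |weightedChiSq hA.eigenvalues x|
    have hx' : (√t * frobeniusNorm A + t * |hA.eigenvalues i|) / 2952 <
      |weightedChiSq hA.eigenvalues x| := hx
    refine lt_of_le_of_lt ?_ hx'
    calc K ≤ 1 / 2952 * (√t * frobeniusNorm A + t * |hA.eigenvalues i|) := by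
          rw [hK]; gcongr
      _ = _ := by ring
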